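/- **Corollary 3.4 (Canonical form for CSS states).** Let $n\ge 0$. A code on $n$ qubits is identified with its codespace $C\subseteq(\mathbb C^2)^{\otimes n}$; its stabilizers are the Pauli operators $i^k\,\sigma_1\otimes\cdots\otimes\sigma_n$ ($\sigma_j\in\{I,X,Y,Z\}$) that fix every vector of $C$. $C$ is a *CSS code* with $k$ inputs if $\dim C=2^k$, $C$ is the intersection of the $+1$ eigenspaces of its stabilizers, and its stabilizer group is generated by operators each of which is a tensor product (with coefficient $+1$) of only $I$'s and $Z$'s or of only $I$'s and $X$'s. A *CSS state* is a CSS code with $0$ inputs, so that $C$ is a line. Consider ZX diagrams in encoder-respecting form with no inputs and $n$ outputs: there are $n$ nodes, numbered $1,\dots,n$; each is an $X$ or a $Z$ node with a phase and has exactly one free (output) edge, which may carry a local (single-qubit unitary) operation; the interior edges form a simple graph on the nodes, and each of them may carry a Hadamard gate. A $Z$ node of phase $\alpha$ is the tensor $|0\cdots0\rangle+e^{i\alpha}|1\cdots1\rangle$ on its legs, an $X$ node of phase $\alpha$ is $|{+}\cdots{+}\rangle+e^{i\alpha}|{-}\cdots{-}\rangle$, and the diagram denotes the vector obtained by contracting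 this tensor network along the interior edges. The diagram expresses the CSS state $C$ if this vector spans $C$ (that is, normalization is ignored). Then for every CSS state $C$ on $n$ qubits there is exactly one such diagram that expresses $C$ and satisfies the following rules: * *Bipartite rule:* every interior edge joins an $X$ node and a $Z$ node. * *Hadamard rule:* each $X$ node is connected only to higher-numbered $Z$ nodes. * *Phase-free rule:* all nodes have phase $0$, and there are no local operations on any free edge. Moreover, no interior edge of this diagram carries a Hadamard gate. -/

import Mathlib

/-- Computational basis labels of `n` qubits. -/
abbrev Bits (n : ℕ) : Type := Fin n → Fin 2

/-- Vectors of the `n`-qubit space, as amplitudes in the computational basis. -/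
abbrev QVec (n : ℕ) : Type := Bits n → ℂ

/-- The tensor product of single-qubit operators, the `i`-th one acting on qubit `i`. -/
def tensorOp {n : ℕ} (A : Fin n → Matrix (Fin 2) (Fin 2) ℂ) : Matrix (Bits n) (Bits n) ℂ :=
  Matrix.of fun x y => ∏ i, A i (x i) (y i)

inductive Pauli : Type
  | I
  | X
  | Y
  | Z

def Pauli.toMatrix : Pauli → Matrix (Fin 2) (Fin 2) ℂ
  | .I => 1
  | .X => !![0, 1; 1, 0]
  | .Y => !![0, -Complex.I; Complex.I, 0]
  | .Z => !![1, 0; 0, -1]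

/-- The tensor product of Pauli matrices described by a Pauli word, with coefficient `+1`. -/
def pauliWord {n : ℕ} (σ : Fin n → Pauli) : Matrix (Bits n) (Bits n) ℂ :=
  tensorOp fun i => (σ i).toMatrix

/-- Pauli operators: Pauli words with a coefficient `i ^ k`. -/
def IsPauliOperator {n : ℕ} (P : Matrix (Bits n) (Bits n) ℂ) : Prop :=
  ∃ (k : Fin 4) (σ : Fin n → Pauli), P = Complex.I ^ (k : ℕ) • pauliWord σ

/-- The group of Pauli operators on `n` qubits. -/
def pauliGroup (n : ℕ) : Subgroup (Matrix (Bits n) (Bits n) ℂ)ˣ :=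
  Subgroup.closure {g | IsPauliOperator (g : Matrix (Bits n) (Bits n) ℂ)}

/-- The invertible operators that fix every vector of `C`. -/
def fixingOperators {n : ℕ} (C : Submodule ℂ (QVec n)) :
    Subgroup (Matrix (Bits n) (Bits n) ℂ)ˣ where
  carrier := {g | ∀ ψ ∈ C, (g : Matrix (Bits n) (Bits n) ℂ).mulVec ψ = ψ}
  one_mem' := by
    intro ψ _
    simp
  mul_mem' := by
    intro a b ha hb ψ hψ
    rw [Units.val_mul, ← Matrix.mulVec_mulVec, hb ψ hψ, ha ψ hψ]
  inv_mem' := by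
    intro a ha ψ hψ
    have h := congrArg ((a⁻¹ : (Matrix (Bits n) (Bits n) ℂ)ˣ) :
      Matrix (Bits n) (Bits n) ℂ).mulVec (ha ψ hψ)
    rw [Matrix.mulVec_mulVec, Units.inv_mul, Matrix.one_mulVec] at h
    exact h.symm

/-- The stabilizers of the code with codespace `C`: the Pauli operators that leave every vector
of `C` unchanged. -/
def stabilizerGroup {n : ℕ} (C : Submodule ℂ (QVec n)) :
    Subgroup (Matrix (Bits n) (Bits n) ℂ)ˣ :=
  pauliGroup n ⊓ fixingOperators C

/-- `C` is the codespace of a Clifford code with `k` inputs and `n` outputs. A code is identified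
with its codespace, the range of an injective encoding of `k` qubits. -/
structure IsCliffordCode {n : ℕ} (k : ℕ) (C : Submodule ℂ (QVec n)) : Prop where
  finrank_eq : Module.finrank ℂ C = 2 ^ k
  /-- The codespace is the intersection of the `+1` eigenspaces of the stabilizers. -/
  mem_iff : ∀ ψ : QVec n, ψ ∈ C ↔
    ∀ g ∈ stabilizerGroup C, (g : Matrix (Bits n) (Bits n) ℂ).mulVec ψ = ψ

/-- Pauli words with only `I` and `Z`. -/
def IsZType {n : ℕ} (P : Matrix (Bits n) (Bits n) ℂ) : Prop :=
  ∃ σ : Fin n → Pauli, (∀ i, σ i = Pauli.I ∨ σ i = Pauli.Z) ∧ P = pauliWord σ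

/-- Pauli words with only `I` and `X`. -/
def IsXType {n : ℕ} (P : Matrix (Bits n) (Bits n) ℂ) : Prop :=
  ∃ σ : Fin n → Pauli, (∀ i, σ i = Pauli.I ∨ σ i = Pauli.X) ∧ P = pauliWord σ

/-- A CSS code: a Clifford code whose stabilizers are generated by operators each of which has
only `I` and `Z` factors or only `I` and `X` factors. -/
structure IsCSSCode {n : ℕ} (k : ℕ) (C : Submodule ℂ (QVec n)) : Prop
    extends IsCliffordCode k C where
  exists_generators : ∃ G : Set (Matrix (Bits n) (Bits n) ℂ)ˣ,
    Subgroup.closure G = stabilizerGroup C ∧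
    ∀ g ∈ G, IsZType (g : Matrix (Bits n) (Bits n) ℂ) ∨ IsXType (g : Matrix (Bits n) (Bits n) ℂ)

/-- A CSS state is a CSS code with zero inputs. -/
def IsCSSState {n : ℕ} (C : Submodule ℂ (QVec n)) : Prop :=
  IsCSSCode 0 C

noncomputable section

def hadamardGate : Matrix (Fin 2) (Fin 2) ℂ :=
  ((Real.sqrt 2 : ℝ) : ℂ)⁻¹ • !![1, 1; 1, -1]

inductive NodeColor : Type
  | X
  | Z

/-- `basisVec c s b` is the `b`-th coordinate of the `s`-th vector of the basis of colour `c`: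
the basis `|0⟩, |1⟩` for `Z` and the basis `|+⟩, |-⟩` for `X`. -/
def basisVec : NodeColor → Fin 2 → Fin 2 → ℂ
  | .Z, s, b => (1 : Matrix (Fin 2) (Fin 2) ℂ) b s
  | .X, s, b => hadamardGate b s

/-- The tensor of a node with phase `α` and legs `ι`: `|0…0⟩ + e^{iα} |1…1⟩` for a `Z` node and
`|+…+⟩ + e^{iα} |-…-⟩` for an `X` node. -/
def spider {ι : Type*} [Fintype ι] (c : NodeColor) (α : Real.Angle) (legs : ι → Fin 2) : ℂ :=
  ∏ l, basisVec c 0 (legs l) + (α.toCircle : ℂ) * ∏ l, basisVec c 1 (legs l)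

/-- ZX diagrams in encoder-respecting form with no inputs and `n` numbered outputs: one node per
output, each with one free edge that may carry a local operation, and interior edges between the
nodes, each of which may carry a Hadamard gate. -/
@[ext]
structure ZXDiagram (n : ℕ) where
  color : Fin n → NodeColor
  phase : Fin n → Real.Angle
  localOp : Fin n → Matrix.unitaryGroup (Fin 2) ℂ
  /-- The interior edges. -/
  graph : SimpleGraph (Fin n)
  /-- The interior edges that carry a Hadamard gate. -/
  hadamardEdges : SimpleGraph (Fin n)
  hadamardEdges_le : hadamardEdges ≤ graph

namespace ZXDiagram

variable {n : ℕ} (D : ZXDiagram n)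

/-- The operator on an interior edge. -/
def edgeMatrix (i j : Fin n) : Matrix (Fin 2) (Fin 2) ℂ :=
  open Classical in if D.hadamardEdges.Adj i j then hadamardGate else 1

open Classical in
/-- The tensor network contracted, before the local operations. A dart is an end of an interior
edge; the sum is over all values of the indices on these ends. The legs of node `i` are its free
edge (`none`) and the ends of interior edges at `i`; each interior edge is counted once, through
its dart from the lower to the higher node. -/
def contraction : QVec n := fun x =>
  ∑ h : D.graph.Dart → Fin 2,
    (∏ i : Fin n, spider (D.color i) (D.phase i)
      (fun l : Option {d : D.graph.Dart // d.fst = i} => l.elim (x i) fun d => h d.1)) *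
    ∏ d : {d : D.graph.Dart // d.fst < d.snd},
      D.edgeMatrix d.1.fst d.1.snd (h d.1) (h d.1.symm)

/-- The vector that the diagram denotes. -/
def toVec : QVec n :=
  (tensorOp fun i => (D.localOp i : Matrix (Fin 2) (Fin 2) ℂ)).mulVec D.contraction

/-- The diagram expresses a code with no inputs if its vector, up to a scalar, is the one that
spans the codespace. -/
def Expresses (C : Submodule ℂ (QVec n)) : Prop :=
  Submodule.span ℂ {D.toVec} = C

/-- Interior edges only join an `X` node and a `Z` node. -/
def BipartiteRule : Prop :=
  ∀ i j, D.graph.Adj i j → D.color i ≠ D.color j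

/-- An `X` node is connected only to higher-numbered `Z` nodes. -/
def HadamardRule : Prop :=
  ∀ i j, D.color i = NodeColor.X → D.graph.Adj i j → D.color j = NodeColor.Z ∧ i < j

/-- All phases are zero and there are no local operations on free edges. -/
def PhaseFreeRule : Prop :=
  (∀ i, D.phase i = 0) ∧ ∀ i, D.localOp i = 1

end ZXDiagram

end

/-! Both sides reduce to binary linear codes. A vector of a CSS state is supported on the code `V`
of words passing the parity checks of the `Z`-type generators. Each `X`-type generator translates
the support by a word, which must then lie in `V`. So the indicator vector `codeVec V` is fixed by
all generators and, the state being a line, spans it (`IsCSSState.exists_span_codeVec`).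

On the diagram side, the rules orient every edge from a lower `X` node to a higher `Z` node. The
spin of a `Z` node is its output bit; without Hadamard gates, summing over the spin of an `X` node
leaves a multiple of `1 + (-1)^parity`. The diagram is therefore the superposition of the words in
which each `X` bit is the sum of its neighbouring `Z` bits (`exists_toVec_eq_smul`). A Hadamard gate
would produce two nonzero opposite amplitudes, impossible for a multiple of `codeVec V`
(`hadamardEdges_eq_bot`).

Such a system of checks is a reduced echelon form of the code, with pivots (last nonzero bits) at
the `Z` nodes. Its existence and uniqueness are `exists_diagram_wordSpace_eq` and
`eq_of_wordSpace_eq`. -/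

section Signs

open Fin.CommRing

/-- The sign `(-1) ^ a` of a bit. -/
def bitSign (a : Fin 2) : ℂ := if a = 0 then 1 else -1

lemma bitSign_zero : bitSign 0 = 1 := by simp [bitSign]

lemma bitSign_one : bitSign 1 = -1 := by simp [bitSign]

lemma bitSign_add (a b : Fin 2) : bitSign (a + b) = bitSign a * bitSign b := by
  fin_cases a <;> fin_cases b <;> simp [bitSign]

lemma bitSign_sum {ι : Type*} (s : Finset ι) (f : ι → Fin 2) :
    bitSign (∑ i ∈ s, f i) = ∏ i ∈ s, bitSign (f i) := by
  classical
  induction s using Finset.induction_on with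
  | empty => simp [bitSign_zero]
  | insert a s ha ih => rw [Finset.sum_insert ha, Finset.prod_insert ha, bitSign_add, ih]

lemma bitSign_eq_one_iff {a : Fin 2} : bitSign a = 1 ↔ a = 0 := by
  fin_cases a <;> norm_num [bitSign]

lemma one_add_bitSign (a : Fin 2) : 1 + bitSign a = if a = 0 then 2 else 0 := by
  fin_cases a <;> norm_num [bitSign]

lemma hadamardGate_apply (a b : Fin 2) :
    hadamardGate a b = ((Real.sqrt 2 : ℝ) : ℂ)⁻¹ * bitSign (a * b) := by
  fin_cases a <;> fin_cases b <;> simp [hadamardGate, bitSign]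

lemma inv_sqrt_two_ne_zero : ((Real.sqrt 2 : ℝ) : ℂ)⁻¹ ≠ 0 := by
  simp

lemma hadamardGate_ne_zero (a b : Fin 2) : hadamardGate a b ≠ 0 := by
  fin_cases a <;> fin_cases b <;> simp [hadamardGate]

lemma hadamardGate_comm (a b : Fin 2) : hadamardGate a b = hadamardGate b a := by
  rw [hadamardGate_apply, hadamardGate_apply, mul_comm a b]

lemma hadamardGate_mul_self : hadamardGate * hadamardGate = 1 := by
  have h : ((Real.sqrt 2 : ℝ) : ℂ)⁻¹ * ((Real.sqrt 2 : ℝ) : ℂ)⁻¹ = 2⁻¹ := by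
    rw [← mul_inv, ← Complex.ofReal_mul, Real.mul_self_sqrt (by norm_num)]
    simp
  ext a b
  fin_cases a <;> fin_cases b <;>
    simp [hadamardGate, Matrix.mul_apply, Fin.sum_univ_two, h] <;> norm_num

end Signs

/-! ### CSS states as binary linear codes -/

section PauliAction

open Fin.CommRing

variable {n : ℕ}

lemma tensorOp_one : tensorOp (fun _ : Fin n => (1 : Matrix (Fin 2) (Fin 2) ℂ)) = 1 := by
  ext x y
  simp only [tensorOp, Matrix.of_apply, Matrix.one_apply, Finset.prod_ite_zero,
    Finset.prod_const_one, Finset.mem_univ, true_implies, funext_iff]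

lemma IsZType.exists_mulVec {P : Matrix (Bits n) (Bits n) ℂ} (hP : IsZType P) :
    ∃ a : Bits n, ∀ (ψ : QVec n) (x : Bits n),
      P.mulVec ψ x = bitSign (∑ i, a i * x i) * ψ x := by
  classical
  obtain ⟨σ, hσ, rfl⟩ := hP
  have h : ∀ i, ∃ a : Fin 2, ∀ u v,
      (σ i).toMatrix u v = if u = v then bitSign (a * u) else 0 := by
    intro i
    rcases hσ i with h | h
    · refine ⟨0, fun u v => ?_⟩
      simp [h, Pauli.toMatrix, Matrix.one_apply, bitSign]
    · refine ⟨1, fun u v => ?_⟩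
      fin_cases u <;> fin_cases v <;> simp [h, Pauli.toMatrix, bitSign]
  choose a ha using h
  refine ⟨a, fun ψ x => ?_⟩
  rw [Matrix.mulVec, dotProduct, Finset.sum_eq_single x]
  · simp [pauliWord, tensorOp, ha, bitSign_sum]
  · intro y _ hy
    obtain ⟨i, hi⟩ := Function.ne_iff.mp hy
    simp only [pauliWord, tensorOp, Matrix.of_apply]
    rw [Finset.prod_eq_zero (Finset.mem_univ i) (by rw [ha, if_neg (Ne.symm hi)]), zero_mul]
  · simp

lemma IsXType.exists_mulVec {P : Matrix (Bits n) (Bits n) ℂ} (hP : IsXType P) :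
    ∃ b : Bits n, ∀ (ψ : QVec n) (x : Bits n), P.mulVec ψ x = ψ (x + b) := by
  classical
  obtain ⟨σ, hσ, rfl⟩ := hP
  have h : ∀ i, ∃ b : Fin 2, ∀ u v,
      (σ i).toMatrix u v = if v = u + b then 1 else 0 := by
    intro i
    rcases hσ i with h | h
    · refine ⟨0, fun u v => ?_⟩
      simp [h, Pauli.toMatrix, Matrix.one_apply, eq_comm]
    · refine ⟨1, fun u v => ?_⟩
      fin_cases u <;> fin_cases v <;> simp [h, Pauli.toMatrix]
  choose b hb using h
  refine ⟨b, fun ψ x => ?_⟩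
  rw [Matrix.mulVec, dotProduct, Finset.sum_eq_single (x + b)]
  · simp [pauliWord, tensorOp, hb]
  · intro y _ hy
    obtain ⟨i, hi⟩ := Function.ne_iff.mp hy
    simp only [pauliWord, tensorOp, Matrix.of_apply]
    rw [Finset.prod_eq_zero (Finset.mem_univ i) (by rw [hb]; exact if_neg hi), zero_mul]
  · simp

open Classical in
/-- The sum of the computational basis vectors labelled by a binary linear code. -/
noncomputable def codeVec (V : Submodule (Fin 2) (Bits n)) : QVec n :=
  fun x => if x ∈ V then 1 else 0

lemma codeVec_zero (V : Submodule (Fin 2) (Bits n)) : codeVec V 0 = 1 := by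
  simp [codeVec]

/-- A CSS state is the uniform superposition of the words of a binary linear code. -/
theorem IsCSSState.exists_span_codeVec {C : Submodule ℂ (QVec n)} (hC : IsCSSState C) :
    ∃ V : Submodule (Fin 2) (Bits n), Submodule.span ℂ {codeVec V} = C := by
  classical
  obtain ⟨G, hG, htype⟩ := hC.exists_generators
  have hfix : ∀ ψ : QVec n, ψ ∈ C ↔
      ∀ g ∈ G, (g : Matrix (Bits n) (Bits n) ℂ).mulVec ψ = ψ := by
    intro ψ
    rw [hC.mem_iff]
    refine ⟨fun h g hg => h g (hG ▸ Subgroup.subset_closure hg), fun h => ?_⟩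
    -- The operators fixing `ψ` form a group, so it suffices to test generators.
    have hle : stabilizerGroup C ≤ fixingOperators (Submodule.span ℂ {ψ}) := by
      rw [← hG, Subgroup.closure_le]
      intro g hg φ hφ
      obtain ⟨c, rfl⟩ := Submodule.mem_span_singleton.mp hφ
      rw [Matrix.mulVec_smul, h g hg]
    exact fun g hg => hle hg ψ (Submodule.mem_span_singleton_self ψ)
  have hrank : Module.finrank ℂ C = 1 := by simpa using hC.finrank_eq
  let V : Submodule (Fin 2) (Bits n) :=
    { carrier := {x | ∀ a : Bits n, (∃ g ∈ G, ∀ (ψ : QVec n) (y : Bits n),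
        (g : Matrix (Bits n) (Bits n) ℂ).mulVec ψ y = bitSign (∑ i, a i * y i) * ψ y) →
          ∑ i, a i * x i = 0}
      add_mem' := by
        intro x y hx hy a ha
        simp [mul_add, Finset.sum_add_distrib, hx a ha, hy a ha]
      zero_mem' := by
        intro a _
        simp
      smul_mem' := by
        intro c x hx a ha
        simp only [Pi.smul_apply, smul_eq_mul, mul_left_comm _ c, ← Finset.mul_sum, hx a ha,
          mul_zero] }
  obtain ⟨ψ, hψ0, -⟩ := finrank_eq_one_iff'.mp hrank
  have hψne : (ψ : QVec n) ≠ 0 := fun h => hψ0 (Subtype.ext h)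
  have hsupp : ∀ x, (ψ : QVec n) x ≠ 0 → x ∈ V := by
    rintro x hx a ⟨g, hg, hga⟩
    have h := congrFun ((hfix ψ).mp ψ.2 g hg) x
    rw [hga] at h
    exact bitSign_eq_one_iff.mp (mul_right_cancel₀ hx (by rw [h, one_mul]))
  obtain ⟨x₀, hx₀⟩ := Function.ne_iff.mp hψne
  have hmem : codeVec V ∈ C := by
    rw [hfix]
    intro g hg
    rcases htype g hg with h | h
    · obtain ⟨a, ha⟩ := h.exists_mulVec
      funext x
      rw [ha]
      by_cases hx : x ∈ V
      · rw [hx a ⟨g, hg, ha⟩, bitSign_zero, one_mul]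
      · simp [codeVec, hx]
    · obtain ⟨b, hb⟩ := h.exists_mulVec
      -- Both `x₀` and `x₀ + b` lie in the support of `ψ`, hence in `V`.
      have hbV : b ∈ V := by
        have h1 := congrFun ((hfix ψ).mp ψ.2 g hg) x₀
        rw [hb] at h1
        have h2 : x₀ + b ∈ V := hsupp _ (by rw [h1]; exact hx₀)
        exact (V.add_mem_iff_right (hsupp x₀ hx₀)).mp h2
      funext x
      rw [hb]
      simp only [codeVec, V.add_mem_iff_left hbV]
  refine ⟨V, Submodule.eq_of_le_of_finrank_eq ?_ ?_⟩
  · rwa [Submodule.span_singleton_le_iff_mem]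
  · rw [hrank, finrank_span_singleton]
    intro h
    have := congrFun h 0
    rw [codeVec_zero] at this
    exact one_ne_zero this

end PauliAction

namespace ZXDiagram

/-! ### Contracting the tensor network -/

section Contraction

open Fin.CommRing

variable {n : ℕ} (D : ZXDiagram n)

open Classical in
/-- An interior dart is the lower or the higher end of a unique interior edge. -/
noncomputable def dartEquiv :
    {d : D.graph.Dart // d.fst < d.snd} ⊕ {d : D.graph.Dart // d.fst < d.snd} ≃
      D.graph.Dart where
  toFun := Sum.elim (fun d => d.1) (fun d => d.1.symm)
  invFun d := if h : d.fst < d.snd then Sum.inl ⟨d, h⟩ else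
    Sum.inr ⟨d.symm, lt_of_le_of_ne (not_lt.mp h) d.adj.symm.ne⟩
  left_inv := by
    rintro (⟨d, h⟩ | ⟨d, h⟩)
    · simp [h]
    · have h' : ¬ d.symm.fst < d.symm.snd := h.not_gt
      exact (dif_neg h').trans (congrArg Sum.inr (Subtype.ext d.symm_symm))
  right_inv := by
    intro d
    by_cases h : d.fst < d.snd <;> simp [h]

open Classical in
/-- The contraction of a product of dart weights and edge weights factors over the edges. -/
lemma sum_darts_eq_prod (f : D.graph.Dart → Fin 2 → ℂ)
    (M : {d : D.graph.Dart // d.fst < d.snd} → Fin 2 → Fin 2 → ℂ) :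
    ∑ h : D.graph.Dart → Fin 2, (∏ d, f d (h d)) *
      ∏ d : {d : D.graph.Dart // d.fst < d.snd}, M d (h d.1) (h d.1.symm) =
    ∏ d : {d : D.graph.Dart // d.fst < d.snd},
      ∑ p : Fin 2 × Fin 2, f d.1 p.1 * f d.1.symm p.2 * M d p.1 p.2 := by
  rw [Finset.prod_univ_sum, Fintype.piFinset_univ]
  let e : (D.graph.Dart → Fin 2) ≃ ({d : D.graph.Dart // d.fst < d.snd} → Fin 2 × Fin 2) :=
    ((Equiv.arrowCongr D.dartEquiv.symm (Equiv.refl _)).trans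
      (Equiv.sumArrowEquivProdArrow _ _ _)).trans (Equiv.arrowProdEquivProdArrow _ _ _).symm
  refine Fintype.sum_equiv e _ _ fun h => ?_
  rw [← Equiv.prod_comp D.dartEquiv, Fintype.prod_sum_type, ← Finset.prod_mul_distrib,
    ← Finset.prod_mul_distrib]
  rfl

/-- The value of an interior edge from an `X` node to a `Z` node, with the given spins. -/
noncomputable def edgeWeight (i j : Fin n) (s t : Fin 2) : ℂ :=
  open Classical in
  if D.hadamardEdges.Adj i j then (1 : Matrix (Fin 2) (Fin 2) ℂ) t s else hadamardGate t s

lemma spider_zero {ι : Type*} [Fintype ι] (c : NodeColor) (legs : ι → Fin 2) :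
    spider c 0 legs = ∑ s, ∏ l, basisVec c s (legs l) := by
  simp [spider, Fin.sum_univ_two]

variable {D}

/-- A `Z` node at the lower end would give an `X` node above its neighbour or a monochromatic edge.
-/
lemma colors_of_lt (hB : D.BipartiteRule) (hH : D.HadamardRule) {i j : Fin n}
    (hij : D.graph.Adj i j) (hlt : i < j) : D.color i = .X ∧ D.color j = .Z := by
  cases hi : D.color i with
  | X => exact ⟨rfl, (hH i j hi hij).1⟩
  | Z =>
    cases hj : D.color j with
    | X => exact absurd (hH j i hj hij.symm).2 hlt.not_gt
    | Z => exact absurd (hi.trans hj.symm) (hB i j hij)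

/-- The two ends use different bases, so a plain edge contributes the change of basis; a Hadamard
gate cancels it, as `H² = 1`. -/
lemma sum_edgeMatrix (i j : Fin n) (s t : Fin 2) :
    ∑ p : Fin 2 × Fin 2, basisVec .X s p.1 * basisVec .Z t p.2 * D.edgeMatrix i j p.1 p.2 =
      D.edgeWeight i j s t := by
  rw [Fintype.sum_prod_type]
  by_cases h : D.hadamardEdges.Adj i j
  · simp only [basisVec, Matrix.one_apply, edgeMatrix, h, if_true, edgeWeight, mul_ite, mul_one,
      mul_zero, ite_mul, zero_mul, Finset.sum_ite_eq', Finset.mem_univ]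
    rw [← Matrix.one_apply, ← hadamardGate_mul_self, Matrix.mul_apply]
    exact Finset.sum_congr rfl fun a _ => by rw [hadamardGate_comm a t, mul_comm]
  · simp [basisVec, Matrix.one_apply, edgeMatrix, h, edgeWeight]

open Classical in
/-- The contraction as a sum over one spin for each node. -/
lemma contraction_eq_sum_spins (hB : D.BipartiteRule) (hH : D.HadamardRule)
    (hP : D.PhaseFreeRule) (x : Bits n) :
    D.contraction x = ∑ s : Bits n, (∏ i, basisVec (D.color i) (s i) (x i)) *
      ∏ d : {d : D.graph.Dart // d.fst < d.snd},
        D.edgeWeight d.1.fst d.1.snd (s d.1.fst) (s d.1.snd) := by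
  have hnode : ∀ h : D.graph.Dart → Fin 2,
      (∏ i : Fin n, spider (D.color i) (D.phase i)
        (fun l : Option {d : D.graph.Dart // d.fst = i} => l.elim (x i) fun d => h d.1)) =
      ∑ s : Bits n, (∏ i, basisVec (D.color i) (s i) (x i)) *
        ∏ d : D.graph.Dart, basisVec (D.color d.fst) (s d.fst) (h d) := by
    intro h
    simp only [hP.1, spider_zero, Finset.prod_univ_sum, Fintype.piFinset_univ]
    refine Finset.sum_congr rfl fun s _ => ?_
    simp only [Fintype.prod_option, Option.elim_none, Option.elim_some, Finset.prod_mul_distrib]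
    congr 1
    rw [← Fintype.prod_fiberwise (fun d : D.graph.Dart => d.fst)]
    refine Finset.prod_congr rfl fun i _ => Finset.prod_congr rfl fun d _ => ?_
    rw [d.2]
  simp only [contraction, hnode, Finset.sum_mul]
  rw [Finset.sum_comm]
  refine Finset.sum_congr rfl fun s _ => ?_
  simp only [mul_assoc, ← Finset.mul_sum]
  congr 1
  rw [D.sum_darts_eq_prod (fun d a => basisVec (D.color d.fst) (s d.fst) a)
    (fun d a b => D.edgeMatrix d.1.fst d.1.snd a b)]
  refine Finset.prod_congr rfl fun d _ => ?_
  obtain ⟨h1, h2⟩ := colors_of_lt hB hH d.1.adj d.2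
  rw [← sum_edgeMatrix]
  rw [← h1, ← h2]
  rfl

open Classical in
/-- The contribution of node `i` to the amplitude at `x`. -/
noncomputable def nodeWeight (D : ZXDiagram n) (x : Bits n) (i : Fin n) : ℂ :=
  ∑ s : Fin 2, basisVec (D.color i) s (x i) *
    ∏ j with D.graph.Adj i j ∧ i < j, D.edgeWeight i j s (x j)

open Classical in
lemma prod_edges_eq (w : Fin n → Fin n → ℂ) :
    ∏ d : {d : D.graph.Dart // d.fst < d.snd}, w d.1.fst d.1.snd =
      ∏ i, ∏ j with D.graph.Adj i j ∧ i < j, w i j := by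
  rw [Finset.prod_sigma']
  refine Finset.prod_bij (fun d _ => ⟨d.1.fst, d.1.snd⟩) ?_ ?_ ?_ ?_
  · intro d _
    simp [d.1.adj, d.2]
  · intro d _ d' _ h
    simp only [Sigma.mk.injEq, heq_eq_eq] at h
    exact Subtype.ext (SimpleGraph.Dart.ext _ _ (Prod.ext h.1 h.2))
  · rintro ⟨i, j⟩ h
    simp only [Finset.mem_sigma, Finset.mem_univ, Finset.mem_filter, true_and] at h
    exact ⟨⟨⟨(i, j), h.1⟩, h.2⟩, Finset.mem_univ _, rfl⟩
  · intro d _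
    rfl

/-- The contraction is a product over the nodes. -/
lemma contraction_eq_prod (hB : D.BipartiteRule) (hH : D.HadamardRule)
    (hP : D.PhaseFreeRule) (x : Bits n) :
    D.contraction x = ∏ i, D.nodeWeight x i := by
  classical
  rw [contraction_eq_sum_spins hB hH hP]
  simp only [nodeWeight, Finset.prod_univ_sum, Fintype.piFinset_univ]
  refine Finset.sum_congr rfl fun s _ => ?_
  rw [Finset.prod_mul_distrib]
  -- `nodeWeight` puts the output bit of a `Z` node in place of its spin; where they differ, both
  -- sides vanish.
  by_cases h : ∀ i, D.color i = .Z → s i = x i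
  · congr 1
    rw [← prod_edges_eq (fun i j => D.edgeWeight i j (s i) (x j))]
    refine Finset.prod_congr rfl fun d _ => ?_
    rw [h _ (colors_of_lt hB hH d.1.adj d.2).2]
  · push Not at h
    obtain ⟨i, hi, hne⟩ := h
    rw [Finset.prod_eq_zero (Finset.mem_univ i), zero_mul, zero_mul]
    simp [hi, basisVec, hne.symm]

lemma toVec_eq_contraction (hP : D.PhaseFreeRule) : D.toVec = D.contraction := by
  simp [toVec, hP.2, tensorOp_one]

lemma toVec_eq_prod (hB : D.BipartiteRule) (hH : D.HadamardRule)
    (hP : D.PhaseFreeRule) (x : Bits n) : D.toVec x = ∏ i, D.nodeWeight x i := by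
  rw [toVec_eq_contraction hP, contraction_eq_prod hB hH hP]

end Contraction

end ZXDiagram

namespace ZXDiagram

/-! ### The code of a diagram and the exclusion of Hadamard gates -/

section CodeOfDiagram

open Fin.CommRing

variable {n : ℕ}

open Classical in
/-- The parity checked by node `i` (if it is an `X` node). -/
noncomputable def parity (D : ZXDiagram n) (x : Bits n) (i : Fin n) : Fin 2 :=
  x i + ∑ j with D.graph.Adj i j ∧ i < j, x j

/-- The binary words that satisfy the parity checks of all `X` nodes. -/
def wordSpace (D : ZXDiagram n) : Submodule (Fin 2) (Bits n) where
  carrier := {x | ∀ i, D.color i = .X → D.parity x i = 0}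
  add_mem' := by
    intro x y hx hy i hi
    have h := congrArg₂ (· + ·) (hx i hi) (hy i hi)
    simp only [parity, add_zero, Pi.add_apply, Finset.sum_add_distrib] at h ⊢
    rw [← h]
    ring
  zero_mem' := by
    intro i _
    simp [parity]
  smul_mem' := by
    intro c x hx i hi
    have h := congrArg (c * ·) (hx i hi)
    simpa [parity, mul_add, Finset.mul_sum] using h

variable {D : ZXDiagram n}

lemma mem_wordSpace {x : Bits n} :
    x ∈ D.wordSpace ↔ ∀ i, D.color i = .X → D.parity x i = 0 := Iff.rfl

lemma nodeWeight_of_color_Z (hB : D.BipartiteRule) (hH : D.HadamardRule) (x : Bits n)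
    {i : Fin n} (hi : D.color i = .Z) : D.nodeWeight x i = 1 := by
  classical
  have h : ∀ j, ¬ (D.graph.Adj i j ∧ i < j) := by
    rintro j ⟨hij, hlt⟩
    have := (colors_of_lt hB hH hij hlt).1
    rw [hi] at this
    cases this
  simp [nodeWeight, hi, h, basisVec, Matrix.one_apply]

open Classical in
lemma nodeWeight_of_color_X (x : Bits n) {i : Fin n} (hi : D.color i = .X)
    (hhad : ∀ j, ¬ D.hadamardEdges.Adj i j) :
    D.nodeWeight x i = ((Real.sqrt 2 : ℝ) : ℂ)⁻¹ *
      (((Real.sqrt 2 : ℝ) : ℂ)⁻¹ ^ (Finset.univ.filter fun j => D.graph.Adj i j ∧ i < j).card) *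
      (if D.parity x i = 0 then 2 else 0) := by
  rw [← one_add_bitSign, parity, bitSign_add, bitSign_sum]
  simp only [nodeWeight, hi, basisVec, edgeWeight, hhad, if_false, hadamardGate_apply,
    Fin.sum_univ_two, mul_zero, mul_one, bitSign_zero, Finset.prod_mul_distrib,
    Finset.prod_const]
  ring

/-- Without Hadamard gates, the diagram denotes the superposition of its word space. -/
lemma exists_toVec_eq_smul (hB : D.BipartiteRule) (hH : D.HadamardRule)
    (hP : D.PhaseFreeRule) (hhad : D.hadamardEdges = ⊥) :
    ∃ c : ℂ, c ≠ 0 ∧ D.toVec = c • codeVec D.wordSpace := by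
  classical
  have key : ∀ i, ∃ c : ℂ, c ≠ 0 ∧ ∀ x, D.nodeWeight x i =
      c * if (D.color i = .X → D.parity x i = 0) then 1 else 0 := by
    intro i
    cases hi : D.color i with
    | Z => exact ⟨1, one_ne_zero, fun x => by simp [nodeWeight_of_color_Z hB hH x hi]⟩
    | X =>
      refine ⟨((Real.sqrt 2 : ℝ) : ℂ)⁻¹ * (((Real.sqrt 2 : ℝ) : ℂ)⁻¹ ^
        (Finset.univ.filter fun j => D.graph.Adj i j ∧ i < j).card) * 2, ?_, fun x => ?_⟩
      · exact mul_ne_zero (mul_ne_zero inv_sqrt_two_ne_zero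
          (pow_ne_zero _ inv_sqrt_two_ne_zero)) two_ne_zero
      · rw [nodeWeight_of_color_X x hi (by simp [hhad])]
        by_cases h : D.parity x i = 0 <;> simp [h]
  choose c hc0 hc using key
  refine ⟨∏ i, c i, Finset.prod_ne_zero_iff.mpr fun i _ => hc0 i, ?_⟩
  funext x
  rw [toVec_eq_prod hB hH hP]
  simp only [hc, Finset.prod_mul_distrib, Finset.prod_ite_zero, Finset.prod_const_one, codeVec,
    Pi.smul_apply, smul_eq_mul, mem_wordSpace, Finset.mem_univ, true_implies]

lemma span_toVec (hB : D.BipartiteRule) (hH : D.HadamardRule)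
    (hP : D.PhaseFreeRule) (hhad : D.hadamardEdges = ⊥) :
    Submodule.span ℂ {D.toVec} = Submodule.span ℂ {codeVec D.wordSpace} := by
  obtain ⟨c, hc, h⟩ := exists_toVec_eq_smul hB hH hP hhad
  rw [h, Submodule.span_singleton_smul_eq (IsUnit.mk0 c hc)]

lemma nodeWeight_congr {x y : Bits n} {i : Fin n} (hi : x i = y i)
    (h : ∀ j, D.graph.Adj i j → i < j → x j = y j) : D.nodeWeight x i = D.nodeWeight y i := by
  classical
  unfold nodeWeight
  rw [hi]
  refine Finset.sum_congr rfl fun s _ => ?_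
  congr 1
  refine Finset.prod_congr rfl fun j hj => ?_
  simp only [Finset.mem_filter, Finset.mem_univ, true_and] at hj
  rw [h j hj.1 hj.2]

/-- The weight of an `X` node with a Hadamard edge, when all its neighbours have bit `1`. -/
lemma nodeWeight_of_hadamard (hH : D.HadamardRule) {i k : Fin n}
    (hi : D.color i = .X) (hk : D.hadamardEdges.Adj i k) :
    ∃ c : ℂ, c ≠ 0 ∧ ∀ y : Bits n, (∀ j, D.graph.Adj i j → i < j → y j = 1) →
      D.nodeWeight y i = hadamardGate (y i) 1 * c := by
  classical
  have hik := D.hadamardEdges_le hk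
  refine ⟨∏ j with D.graph.Adj i j ∧ i < j, D.edgeWeight i j 1 1, ?_, fun y hy => ?_⟩
  · refine Finset.prod_ne_zero_iff.mpr fun j _ => ?_
    unfold edgeWeight
    split_ifs
    · simp
    · exact hadamardGate_ne_zero 1 1
  · have h : ∀ s, ∏ j with D.graph.Adj i j ∧ i < j, D.edgeWeight i j s (y j) =
        ∏ j with D.graph.Adj i j ∧ i < j, D.edgeWeight i j s 1 := by
      refine fun s => Finset.prod_congr rfl fun j hj => ?_
      simp only [Finset.mem_filter, Finset.mem_univ, true_and] at hj
      rw [hy j hj.1 hj.2]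
    -- The Hadamard edge forces the spin of `i` to equal the bit `1` of `k`.
    have h0 : ∏ j with D.graph.Adj i j ∧ i < j, D.edgeWeight i j 0 1 = 0 := by
      refine Finset.prod_eq_zero (i := k) ?_ ?_
      · simp [hik, (hH i k hi hik).2]
      · simp [edgeWeight, hk]
    simp only [nodeWeight, h, Fin.sum_univ_two, h0, mul_zero, zero_add, hi, basisVec]

/-- A diagram that denotes the superposition of a linear code has no Hadamard gates. -/
lemma hadamardEdges_eq_bot (hB : D.BipartiteRule) (hH : D.HadamardRule)
    (hP : D.PhaseFreeRule) {V : Submodule (Fin 2) (Bits n)}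
    (hV : Submodule.span ℂ {D.toVec} = Submodule.span ℂ {codeVec V}) :
    D.hadamardEdges = ⊥ := by
  classical
  by_contra hne
  obtain ⟨i, k, hik⟩ : ∃ i k, D.hadamardEdges.Adj i k ∧ i < k := by
    obtain ⟨i, k, h⟩ := SimpleGraph.ne_bot_iff_exists_adj.mp hne
    rcases lt_or_gt_of_ne h.ne with hlt | hlt
    · exact ⟨i, k, h, hlt⟩
    · exact ⟨k, i, h.symm, hlt⟩
  have hiX := (colors_of_lt hB hH (D.hadamardEdges_le hik.1) hik.2).1
  -- All `Z` bits are `1`, and each `X` node without Hadamard edges gets the bit that satisfies its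
  -- check, so the amplitude at `x` is nonzero.
  let x : Bits n := fun j => if D.color j = .X ∧ ∀ l, ¬ D.hadamardEdges.Adj j l
    then ∑ l with D.graph.Adj j l ∧ j < l, 1 else 1
  have hxZ : ∀ j, D.color j = .Z → x j = 1 := fun j hj => by simp [x, hj]
  have hx1 : ∀ j l, D.graph.Adj j l → j < l → x l = 1 := fun j l hjl hlt =>
    hxZ l (colors_of_lt hB hH hjl hlt).2
  have hpos : ∀ j, D.nodeWeight x j ≠ 0 := by
    intro j
    cases hj : D.color j with
    | Z => simp [nodeWeight_of_color_Z hB hH x hj]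
    | X =>
      by_cases hhad : ∀ l, ¬ D.hadamardEdges.Adj j l
      · have hpar : D.parity x j = 0 := by
          have hs : ∑ l with D.graph.Adj j l ∧ j < l, x l =
              ∑ l with D.graph.Adj j l ∧ j < l, 1 := by
            refine Finset.sum_congr rfl fun l hl => ?_
            simp only [Finset.mem_filter, Finset.mem_univ, true_and] at hl
            exact hx1 j l hl.1 hl.2
          have hxj : x j = ∑ l with D.graph.Adj j l ∧ j < l, 1 := if_pos ⟨hj, hhad⟩
          have h2 : ∀ a : Fin 2, a + a = 0 := by decide
          rw [parity, hs, hxj, h2]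
        rw [nodeWeight_of_color_X x hj hhad, if_pos hpar]
        exact mul_ne_zero (mul_ne_zero inv_sqrt_two_ne_zero
          (pow_ne_zero _ inv_sqrt_two_ne_zero)) two_ne_zero
      · push Not at hhad
        obtain ⟨l, hl⟩ := hhad
        obtain ⟨c, hc, h⟩ := nodeWeight_of_hadamard hH hj hl
        rw [h x (hx1 j)]
        exact mul_ne_zero (hadamardGate_ne_zero _ _) hc
  -- As `i` is an `X` node, no other node weight depends on its bit.
  let y : Bits n := Function.update x i (x i + 1)
  have hy1 : ∀ j l, D.graph.Adj j l → j < l → y l = x l := by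
    intro j l hjl hlt
    refine Function.update_of_ne ?_ _ _
    rintro rfl
    have := (colors_of_lt hB hH hjl hlt).2
    rw [hiX] at this
    cases this
  have hyi : D.nodeWeight y i = - D.nodeWeight x i := by
    obtain ⟨c, -, h⟩ := nodeWeight_of_hadamard hH hiX hik.1
    rw [h x (hx1 i), h y fun l hil hlt => (hy1 i l hil hlt).trans (hx1 i l hil hlt)]
    have : y i = x i + 1 := Function.update_self _ _ _
    rw [this, hadamardGate_apply, hadamardGate_apply, mul_one, mul_one, bitSign_add, bitSign_one]
    ring
  have hyx : D.toVec y = - D.toVec x := by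
    rw [toVec_eq_prod hB hH hP, toVec_eq_prod hB hH hP, Fintype.prod_eq_mul_prod_compl i,
      Fintype.prod_eq_mul_prod_compl i (D.nodeWeight x), hyi, neg_mul]
    congr 2
    refine Finset.prod_congr rfl fun j hj => nodeWeight_congr ?_ (hy1 j)
    exact Function.update_of_ne (by simpa using hj) _ _
  have hx0 : D.toVec x ≠ 0 := by
    rw [toVec_eq_prod hB hH hP]
    exact Finset.prod_ne_zero_iff.mpr fun j _ => hpos j
  obtain ⟨c, hc⟩ := Submodule.mem_span_singleton.mp
    (hV ▸ Submodule.mem_span_singleton_self D.toVec)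
  rw [← hc] at hyx hx0
  by_cases hxV : x ∈ V <;> by_cases hyV : y ∈ V <;> simp [codeVec, hxV, hyV] at hyx hx0
  · exact hx0 (self_eq_neg.mp hyx)
  · exact hx0 hyx

end CodeOfDiagram

end ZXDiagram

/-! ### Uniqueness of the reduced echelon form -/

section Uniqueness

open Fin.CommRing

variable {n : ℕ}

lemma span_codeVec_injective {V W : Submodule (Fin 2) (Bits n)}
    (h : Submodule.span ℂ {codeVec V} = Submodule.span ℂ {codeVec W}) : V = W := by
  classical
  obtain ⟨c, hc⟩ := Submodule.mem_span_singleton.mp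
    (h ▸ Submodule.mem_span_singleton_self (codeVec V))
  have h0 := congrFun hc 0
  rw [Pi.smul_apply, codeVec_zero, codeVec_zero, smul_eq_mul, mul_one] at h0
  rw [h0, one_smul] at hc
  ext x
  have hx := congrFun hc x
  by_cases hV : x ∈ V <;> by_cases hW : x ∈ W <;> simp [codeVec, hV, hW] at hx ⊢

namespace ZXDiagram

variable {D D' : ZXDiagram n}

open Classical in
/-- The word of the code with bit `1` at the `Z` node `i` and bit `0` at all other `Z` nodes. -/
noncomputable def basicWord (D : ZXDiagram n) (i : Fin n) : Bits n :=
  fun j => if j = i ∨ D.graph.Adj j i then 1 else 0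

lemma basicWord_of_color_Z (hB : D.BipartiteRule) {i j : Fin n} (hi : D.color i = .Z)
    (hj : D.color j = .Z) : D.basicWord i j = if j = i then 1 else 0 := by
  have : ¬ D.graph.Adj j i := fun h => hB j i h (hj.trans hi.symm)
  simp [basicWord, this]

lemma basicWord_of_color_X {i j : Fin n} (hi : D.color i = .Z) (hj : D.color j = .X) :
    D.basicWord i j = 1 ↔ D.graph.Adj j i := by
  have : j ≠ i := by
    rintro rfl
    rw [hi] at hj
    cases hj
  simp [basicWord, this]

-- The word is prescribed only at `Z` nodes, the only ones a check sums over, so that basic words of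
-- another diagram with the same colours are covered.
open Classical in
lemma parity_basicWord (hB : D.BipartiteRule) (hH : D.HadamardRule) (w : Bits n) {i : Fin n}
    (hw : ∀ j, D.color j = .Z → w j = if j = i then 1 else 0) {j : Fin n} :
    D.parity w j = w j + if D.graph.Adj j i ∧ j < i then 1 else 0 := by
  rw [parity]
  congr 1
  rw [Finset.sum_filter]
  have : ∀ k, (if D.graph.Adj j k ∧ j < k then w k else 0) =
      if i = k then (if D.graph.Adj j i ∧ j < i then 1 else 0) else 0 := by
    intro k
    by_cases h : D.graph.Adj j k ∧ j < k
    · rw [if_pos h, hw k (colors_of_lt hB hH h.1 h.2).2]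
      by_cases hk : k = i
      · subst hk
        simp [h]
      · simp [hk, Ne.symm hk]
    · rw [if_neg h]
      by_cases hk : i = k
      · subst hk
        simp [h]
      · simp [hk]
  rw [Finset.sum_congr rfl fun k _ => this k]
  simp

lemma basicWord_mem_wordSpace (hB : D.BipartiteRule) (hH : D.HadamardRule) {i : Fin n}
    (hi : D.color i = .Z) : D.basicWord i ∈ D.wordSpace := by
  classical
  intro j hj
  rw [parity_basicWord hB hH _ fun k hk => basicWord_of_color_Z hB hi hk]
  by_cases h : D.graph.Adj j i
  · rw [(basicWord_of_color_X hi hj).mpr h, if_pos ⟨h, (hH j i hj h).2⟩]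
    rfl
  · have : j ≠ i := by
      rintro rfl
      rw [hi] at hj
      cases hj
    simp [basicWord, h, this]

/-- The `X` nodes are the positions at which no word of the code has its last nonzero bit. -/
lemma color_eq_X_iff (hB : D.BipartiteRule) (hH : D.HadamardRule) (i : Fin n) :
    D.color i = .X ↔ ∀ w ∈ D.wordSpace, (∀ j, i < j → w j = 0) → w i = 0 := by
  classical
  constructor
  · intro hi w hw h
    have := hw i hi
    rw [parity, Finset.sum_eq_zero, add_zero] at this
    · exact this
    · intro j hj
      simp only [Finset.mem_filter, Finset.mem_univ, true_and] at hj
      exact h j hj.2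
  · intro h
    cases hi : D.color i with
    | X => rfl
    | Z =>
      exfalso
      have h0 := h _ (basicWord_mem_wordSpace hB hH hi) fun j hj => ?_
      · simp [basicWord] at h0
      · have hne : ¬ D.graph.Adj j i := by
          intro hji
          have := (colors_of_lt hB hH hji.symm hj).1
          rw [hi] at this
          cases this
        simp [basicWord, hne, hj.ne']

lemma color_eq_of_wordSpace_eq (hB : D.BipartiteRule) (hH : D.HadamardRule)
    (hB' : D'.BipartiteRule) (hH' : D'.HadamardRule) (h : D.wordSpace = D'.wordSpace) :
    D.color = D'.color := by
  funext i
  have hi := color_eq_X_iff hB hH i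
  rw [h, ← color_eq_X_iff hB' hH' i] at hi
  cases h1 : D.color i <;> cases h2 : D'.color i <;> simp [h1, h2] at hi ⊢

/-- The basic word of the `Z` end in `D` has bit `1` at the `X` end; the check of that node in `D'`
can cancel it only through the same edge. -/
lemma adj_of_wordSpace_eq (hB : D.BipartiteRule) (hH : D.HadamardRule)
    (hB' : D'.BipartiteRule) (hH' : D'.HadamardRule) (h : D.wordSpace = D'.wordSpace)
    {i j : Fin n} (hij : D.graph.Adj i j) : D'.graph.Adj i j := by
  classical
  have hcol := color_eq_of_wordSpace_eq hB hH hB' hH' h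
  wlog hlt : i < j generalizing i j
  · exact (this hij.symm (lt_of_le_of_ne (not_lt.mp hlt) hij.symm.ne)).symm
  obtain ⟨hi, hj⟩ := colors_of_lt hB hH hij hlt
  have hmem : D.basicWord j ∈ D'.wordSpace := h ▸ basicWord_mem_wordSpace hB hH hj
  have hpar := hmem i (hcol ▸ hi)
  rw [parity_basicWord hB' hH' _ fun k hk => basicWord_of_color_Z hB hj (hcol ▸ hk),
    (basicWord_of_color_X hj hi).mpr hij] at hpar
  by_contra hn
  simp [hn] at hpar

/-- A diagram in canonical form is determined by its binary code. -/
lemma eq_of_wordSpace_eq (hB : D.BipartiteRule) (hH : D.HadamardRule) (hP : D.PhaseFreeRule)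
    (hhad : D.hadamardEdges = ⊥) (hB' : D'.BipartiteRule) (hH' : D'.HadamardRule)
    (hP' : D'.PhaseFreeRule) (hhad' : D'.hadamardEdges = ⊥) (h : D.wordSpace = D'.wordSpace) :
    D = D' := by
  refine ZXDiagram.ext (color_eq_of_wordSpace_eq hB hH hB' hH' h) ?_ ?_ ?_ (hhad.trans hhad'.symm)
  · funext i
    rw [hP.1, hP'.1]
  · funext i
    rw [hP.2, hP'.2]
  · ext i j
    exact ⟨adj_of_wordSpace_eq hB hH hB' hH' h, adj_of_wordSpace_eq hB' hH' hB hH h.symm⟩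

end ZXDiagram

end Uniqueness

/-! ### Existence by Gaussian elimination -/

section Existence

open Fin.CommRing

variable {n : ℕ}

/-- The position `i` carries the last nonzero bit of some word of the code. -/
def IsLastPosition (V : Submodule (Fin 2) (Bits n)) (i : Fin n) : Prop :=
  ∃ w ∈ V, (∀ j, i < j → w j = 0) ∧ w i = 1

/-- A nonzero word is itself the witness that its last nonzero bit is at a last position. -/
lemma eq_zero_of_forall_isLastPosition {V : Submodule (Fin 2) (Bits n)} {w : Bits n}
    (hw : w ∈ V) (h : ∀ i, IsLastPosition V i → w i = 0) : w = 0 := by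
  classical
  by_contra hne
  obtain ⟨k, hk⟩ := Function.ne_iff.mp hne
  obtain ⟨i, hi, hmax⟩ :=
    (Finset.univ.filter fun i => w i ≠ 0).exists_max_image id ⟨k, by simpa using hk⟩
  simp only [Finset.mem_filter, Finset.mem_univ, true_and, id] at hi hmax
  refine hi (h i ⟨w, hw, fun j hj => ?_, Fin.eq_one_of_ne_zero _ hi⟩)
  by_contra hj0
  exact (hmax j hj0).not_gt hj

/-- The words of the reduced basis of a binary code. -/
lemma exists_reducedWord (V : Submodule (Fin 2) (Bits n)) (i : Fin n) :
    IsLastPosition V i → ∃ w ∈ V, (∀ j, i < j → w j = 0) ∧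
      ∀ j, IsLastPosition V j → w j = if j = i then 1 else 0 := by
  classical
  induction i using WellFoundedLT.induction with
  | _ i ih =>
  rintro ⟨w, hw, hw0, hwi⟩
  choose! v hvV hv0 hv using ih
  let S := Finset.univ.filter fun k => k < i ∧ IsLastPosition V k
  have hS : ∀ k ∈ S, k < i ∧ IsLastPosition V k := fun k hk => by simpa [S] using hk
  have hsum : ∀ j, (∀ k ∈ S, w k * v k j = if j = k then w k else 0) →
      (w + ∑ k ∈ S, w k • v k) j = w j + if j ∈ S then w j else 0 := by
    intro j hj
    rw [Pi.add_apply, Finset.sum_apply]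
    simp only [Pi.smul_apply, smul_eq_mul]
    rw [Finset.sum_congr rfl hj, Finset.sum_ite_eq]
  -- In characteristic two, adding `w k • v k` clears the bit at the pivot `k < i` and leaves the
  -- other pivots unchanged.
  refine ⟨w + ∑ k ∈ S, w k • v k, V.add_mem hw (V.sum_mem fun k hk =>
    V.smul_mem _ (hvV k (hS k hk).1 (hS k hk).2)), fun j hj => ?_, fun j hj => ?_⟩
  · rw [hsum j]
    · have : j ∉ S := fun h => (hS j h).1.not_gt hj
      simp [this, hw0 j hj]
    · intro k hk
      have hkj := (hS k hk).1.trans hj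
      rw [hv0 k (hS k hk).1 (hS k hk).2 j hkj, if_neg hkj.ne', mul_zero]
  · rw [hsum j]
    · rcases lt_trichotomy j i with h | rfl | h
      · have : j ∈ S := by simp [S, h, hj]
        have h2 : ∀ a : Fin 2, a + a = 0 := by decide
        rw [if_pos this, if_neg h.ne, h2]
      · simp [S, hwi]
      · have : j ∉ S := fun h' => (hS j h').1.not_gt h
        simp [this, hw0 j h, h.ne']
    · intro k hk
      rw [hv k (hS k hk).1 (hS k hk).2 j hj]
      simp

/-- Every binary linear code is the word space of a diagram in canonical form. -/
theorem exists_diagram_wordSpace_eq (V : Submodule (Fin 2) (Bits n)) :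
    ∃ D : ZXDiagram n, D.BipartiteRule ∧ D.HadamardRule ∧ D.PhaseFreeRule ∧
      D.hadamardEdges = ⊥ ∧ D.wordSpace = V := by
  classical
  choose! v hvV hv0 hv using exists_reducedWord V
  let adj : Fin n → Fin n → Prop := fun i j =>
    ¬ IsLastPosition V i ∧ IsLastPosition V j ∧ v j i = 1
  have adj_lt : ∀ i j, adj i j → i < j := by
    rintro i j ⟨hi, hj, hji⟩
    by_contra hlt
    rcases (not_lt.mp hlt).eq_or_lt with rfl | h
    · exact hi hj
    · rw [hv0 j hj i h] at hji
      exact zero_ne_one hji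
  let D : ZXDiagram n :=
    { color := fun i => if IsLastPosition V i then .Z else .X
      phase := fun _ => 0
      localOp := fun _ => 1
      graph :=
        { Adj := fun i j => adj i j ∨ adj j i
          symm := ⟨fun _ _ h => h.symm⟩
          loopless := ⟨fun i h => h.elim (fun h => h.1 h.2.1) (fun h => h.1 h.2.1)⟩ }
      hadamardEdges := ⊥
      hadamardEdges_le := bot_le }
  have hX : ∀ i, D.color i = .X ↔ ¬ IsLastPosition V i := fun i => by
    by_cases h : IsLastPosition V i <;> simp [D, h]
  have hZ : ∀ i, D.color i = .Z ↔ IsLastPosition V i := fun i => by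
    by_cases h : IsLastPosition V i <;> simp [D, h]
  have hadj : ∀ i j, ¬ IsLastPosition V i → D.graph.Adj i j → adj i j := fun i j hi h =>
    h.elim id fun h => absurd h.2.1 hi
  have hparity : ∀ (x : Bits n) (i : Fin n), ¬ IsLastPosition V i →
      D.parity x i = x i + ∑ j with IsLastPosition V j, x j * v j i := by
    intro x i hi
    rw [ZXDiagram.parity, Finset.sum_filter, Finset.sum_filter]
    congr 1
    refine Finset.sum_congr rfl fun j _ => ?_
    by_cases h : adj i j
    · rw [if_pos ⟨Or.inl h, adj_lt i j h⟩, if_pos h.2.1, h.2.2, mul_one]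
    · rw [if_neg fun h' => h (hadj i j hi h'.1)]
      split_ifs with hj
      · have h0 : v j i = 0 := by
          by_contra hne
          exact h ⟨hi, hj, Fin.eq_one_of_ne_zero _ hne⟩
        rw [h0, mul_zero]
      · rfl
  have hlast : ∀ (x : Bits n) (i : Fin n), IsLastPosition V i →
      ∑ j with IsLastPosition V j, x j * v j i = x i := by
    intro x i hi
    rw [Finset.sum_congr rfl (g := fun j => if i = j then x j else 0)]
    · simp [hi]
    · intro j hj
      rw [hv j (by simpa using hj) i hi]
      simp
  have hsum : ∀ x : Bits n, ∑ j with IsLastPosition V j, x j • v j ∈ V := fun x =>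
    V.sum_mem fun j hj => V.smul_mem _ (hvV j (by simpa using hj))
  have happ : ∀ (x : Bits n) (i : Fin n), (∑ j with IsLastPosition V j, x j • v j) i =
      ∑ j with IsLastPosition V j, x j * v j i := fun x i => by
    simp [Finset.sum_apply]
  have hiff : ∀ a b : Fin 2, a + b = 0 ↔ a = b := by decide
  refine ⟨D, ?_, ?_, ⟨fun _ => rfl, fun _ => rfl⟩, rfl, ?_⟩
  · rintro i j (h | h)
    · rw [(hX i).mpr h.1, (hZ j).mpr h.2.1]
      simp
    · rw [(hX j).mpr h.1, (hZ i).mpr h.2.1]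
      simp
  · intro i j hi hij
    have h := hadj i j ((hX i).mp hi) hij
    exact ⟨(hZ j).mpr h.2.1, adj_lt i j h⟩
  · ext x
    constructor
    · intro hx
      have : x = ∑ j with IsLastPosition V j, x j • v j := by
        funext i
        rw [happ]
        by_cases hi : IsLastPosition V i
        · rw [hlast x i hi]
        · have := hx i ((hX i).mpr hi)
          rwa [hparity x i hi, hiff] at this
      rw [this]
      exact hsum x
    · intro hx i hi
      -- A codeword agrees with its expansion in the reduced words at all pivots, hence everywhere;
      -- at an `X` node this is the check.
      have h0 := eq_zero_of_forall_isLastPosition (V.add_mem hx (hsum x)) fun i hi => by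
        rw [Pi.add_apply, happ, hlast x i hi, hiff]
      have := congrFun h0 i
      rwa [Pi.add_apply, happ, ← hparity x i ((hX i).mp hi)] at this

end Existence

theorem corollary3p4 (n : ℕ) (C : Submodule ℂ (QVec n)) (hC : IsCSSState C) :
    ∃ D : ZXDiagram n,
      (D.BipartiteRule ∧ D.HadamardRule ∧ D.PhaseFreeRule ∧ D.Expresses C) ∧
      D.hadamardEdges = ⊥ ∧
      ∀ D' : ZXDiagram n,
        D'.BipartiteRule ∧ D'.HadamardRule ∧ D'.PhaseFreeRule ∧ D'.Expresses C → D' = D := by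
  obtain ⟨V, hV⟩ := hC.exists_span_codeVec
  obtain ⟨D, hB, hH, hP, hhad, hD⟩ := exists_diagram_wordSpace_eq V
  refine ⟨D, ⟨hB, hH, hP, ?_⟩, hhad, ?_⟩
  · rw [ZXDiagram.Expresses, ZXDiagram.span_toVec hB hH hP hhad, hD, hV]
  · rintro D' ⟨hB', hH', hP', hE⟩
    have hspan : Submodule.span ℂ {D'.toVec} = Submodule.span ℂ {codeVec V} := hE.trans hV.symm
    -- The rules permit Hadamard gates in a competitor, so they must be excluded before codes are
    -- compared.
    have hhad' := ZXDiagram.hadamardEdges_eq_bot hB' hH' hP' hspan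
    have hD' : D'.wordSpace = V := by
      rw [ZXDiagram.span_toVec hB' hH' hP' hhad'] at hspan
      exact span_codeVec_injective hspan
    exact ZXDiagram.eq_of_wordSpace_eq hB' hH' hP' hhad' hB hH hP hhad (hD'.trans hD.symm)
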